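/- Let $\mathbb K$ be a field of characteristic zero, let $n\ge 1$, and let $d_0,\dots,d_n$ be positive integers (weights) with $\gcd(d_0,\dots,d_n)=1$. Let $\mathbf D=\mathbb K\langle x_0,\dots,x_n,\partial_0,\dots,\partial_n\rangle$ be the Weyl algebra, graded by $\deg x_i=d_i$, $\deg\partial_i=-d_i$; let $\mathbf D_0$ be its subalgebra of elements of degree $0$, let $\mathbf A=\mathbb K[x_0,\dots,x_n]=\bigoplus_{k\ge 0}\mathbf A_k\subset\mathbf D$ with the induced grading, and let $\mathbf E=\sum_i d_i x_i\partial_i\in\mathbf D_0$ be the Euler field, which is central in $\mathbf D_0$. For a left $\mathbf D$-module $M$ and $\mu\in\mathbb K$ put $M^\mu=\{m\in M: \mathbf E m=\mu m\}$. Fix $\lambda\in\mathbb K$. A left $\mathbf D$-module $M$ is called $\lambda$-Euler if $M=\bigoplus_{k\in\mathbb Z}M^{\lambda+k}$; it is then canonically $\mathbb Z$-graded by $M_k=M^{\lambda+k}$, and the $\lambda$-Euler modules with the $\mathbf D$-linear maps form a category $\mathbf D\text{-}\mathrm{Gr}^\lambda$. Such an $M$ is torsion if for every $m\in M$ there is an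 $N$ with $\mathbf A_k m=0$ for all $k>N$; the torsion modules form a Serre subcategory $\mathbf D\text{-}\mathrm{Tors}^\lambda$. The category of $\lambda$-twisted D-modules on the weighted projective stack $[\mathbb P(V)]=[(V\setminus\{0\})/\mathbb G_m]$, where $V$ has dimension $n+1$ and weights $d_0,\dots,d_n$, is by definition the Serre quotient $$\mathcal D^\lambda_{[X]}\text{-}\mathrm{Qcoh}=\mathbf D\text{-}\mathrm{Gr}^\lambda/\mathbf D\text{-}\mathrm{Tors}^\lambda .$$ Let $\pi_\lambda:\mathbf D\text{-}\mathrm{Gr}^\lambda\to\mathcal D^\lambda_{[X]}\text{-}\mathrm{Qcoh}$ be the quotient functor and $\omega_\lambda$ its right adjoint (the section functor). The global sections functor is $$\Gamma_\lambda:\mathcal D^\lambda_{[X]}\text{-}\mathrm{Qcoh}\to (D^\lambda_{[X]})_0\text{-}\mathrm{Mod},\qquad \Gamma_\lambda(\mathcal M)=\omega_\lambda(\mathcal M)_0=\omega_\lambda(\mathcal M)^\lambda,$$ where $(D^\lambda_{[X]})_0=\mathbf D_0/\mathbf D_0(\mathbf E-\lambda)$. Let $\mathcal A=\{\sum_i a_i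 d_i : a_i\in\mathbb Z_{\ge 0}\}$. If $\lambda\in(\mathbb K\setminus\mathbb Z)\cup\mathcal A$, then the right adjoint $\omega_\lambda$ exists and $\Gamma_\lambda$ is an equivalence of categories. -/

import Mathlib

open CategoryTheory

universe u

namespace WeightedDMod

/-! ### The Weyl algebra and its grading -/

/-- Defining relations of the Weyl algebra in the letters `Sum.inl i` (for `x_i`) and
`Sum.inr i` (for `∂_i`). -/
inductive WeylRel (K : Type u) [Field K] (n : ℕ) :
    FreeAlgebra K (Fin (n + 1) ⊕ Fin (n + 1)) →
      FreeAlgebra K (Fin (n + 1) ⊕ Fin (n + 1)) → Prop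
  | x_comm (i j : Fin (n + 1)) : WeylRel K n
      (FreeAlgebra.ι K (Sum.inl i) * FreeAlgebra.ι K (Sum.inl j))
      (FreeAlgebra.ι K (Sum.inl j) * FreeAlgebra.ι K (Sum.inl i))
  | dd_comm (i j : Fin (n + 1)) : WeylRel K n
      (FreeAlgebra.ι K (Sum.inr i) * FreeAlgebra.ι K (Sum.inr j))
      (FreeAlgebra.ι K (Sum.inr j) * FreeAlgebra.ι K (Sum.inr i))
  | dd_x (i j : Fin (n + 1)) : WeylRel K n
      (FreeAlgebra.ι K (Sum.inr i) * FreeAlgebra.ι K (Sum.inl j))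
      (FreeAlgebra.ι K (Sum.inl j) * FreeAlgebra.ι K (Sum.inr i) + if i = j then 1 else 0)

/-- The Weyl algebra `K⟨x_0, …, x_n, ∂_0, …, ∂_n⟩`. -/
def Weyl (K : Type u) [Field K] (n : ℕ) : Type u := RingQuot (WeylRel K n)

noncomputable instance (K : Type u) [Field K] (n : ℕ) : Ring (Weyl K n) :=
  inferInstanceAs (Ring (RingQuot (WeylRel K n)))

noncomputable instance (K : Type u) [Field K] (n : ℕ) : Algebra K (Weyl K n) :=
  inferInstanceAs (Algebra K (RingQuot (WeylRel K n)))

/-- The quotient map from the free algebra to the Weyl algebra. -/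
noncomputable def Weyl.mk (K : Type u) [Field K] (n : ℕ) :
    FreeAlgebra K (Fin (n + 1) ⊕ Fin (n + 1)) →ₐ[K] Weyl K n :=
  RingQuot.mkAlgHom K (WeylRel K n)

theorem Weyl.mk_rel {K : Type u} [Field K] {n : ℕ}
    {a b : FreeAlgebra K (Fin (n + 1) ⊕ Fin (n + 1))} (h : WeylRel K n a b) :
    Weyl.mk K n a = Weyl.mk K n b :=
  RingQuot.mkAlgHom_rel K h

section Algebra

variable (K : Type u) [Field K] {n : ℕ}

/-- The generators of the Weyl algebra: `Sum.inl i ↦ x_i` and `Sum.inr i ↦ ∂_i`. -/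
noncomputable def gen (s : Fin (n + 1) ⊕ Fin (n + 1)) : Weyl K n :=
  Weyl.mk K n (FreeAlgebra.ι K s)

/-- The coordinate function `x_i`. -/
noncomputable def x (i : Fin (n + 1)) : Weyl K n := gen K (Sum.inl i)

/-- The partial derivative `∂_i`. -/
noncomputable def dd (i : Fin (n + 1)) : Weyl K n := gen K (Sum.inr i)

theorem x_mul_x (i j : Fin (n + 1)) : x K i * x K j = x K j * x K i := by
  simpa [x, gen] using Weyl.mk_rel (WeylRel.x_comm (K := K) i j)

theorem dd_mul_dd (i j : Fin (n + 1)) : dd K i * dd K j = dd K j * dd K i := by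
  simpa [dd, gen] using Weyl.mk_rel (WeylRel.dd_comm (K := K) i j)

theorem dd_mul_x (i j : Fin (n + 1)) :
    dd K i * x K j = x K j * dd K i + if i = j then 1 else 0 := by
  have h := Weyl.mk_rel (WeylRel.dd_x (K := K) i j)
  split_ifs at h ⊢ with hij <;> simpa [x, dd, gen, hij] using h

/-- The degrees of the generators: `deg x_i = d_i`, `deg ∂_i = -d_i`. -/
def genDeg (d : Fin (n + 1) → ℕ) : Fin (n + 1) ⊕ Fin (n + 1) → ℤ :=
  Sum.elim (fun i => (d i : ℤ)) (fun i => -(d i : ℤ))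

/-- The homogeneous component `D_k` of the Weyl algebra: the span of all words of degree `k`
in the generators. -/
noncomputable def weylPart (d : Fin (n + 1) → ℕ) (k : ℤ) : Submodule K (Weyl K n) :=
  Submodule.span K
    {w | ∃ l : List (Fin (n + 1) ⊕ Fin (n + 1)),
      (l.map (genDeg d)).sum = k ∧ (l.map (gen K)).prod = w}

/-- The homogeneous component `A_k` of the polynomial subalgebra `A = K[x_0, …, x_n]` of the
Weyl algebra: the span of all words of degree `k` in the `x_i`, where `deg x_i = d_i`. -/
noncomputable def polyPart (d : Fin (n + 1) → ℕ) (k : ℕ) : Submodule K (Weyl K n) :=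
  Submodule.span K
    {w | ∃ l : List (Fin (n + 1)), (l.map d).sum = k ∧ (l.map (x K)).prod = w}

instance weylPart_gradedMonoid (d : Fin (n + 1) → ℕ) :
    SetLike.GradedMonoid (weylPart K d) where
  one_mem := Submodule.subset_span ⟨[], by simp, by simp⟩
  mul_mem := by
    intro i j a b ha hb
    have h : a * b ∈ weylPart K d i * weylPart K d j := Submodule.mul_mem_mul ha hb
    rw [weylPart, weylPart, Submodule.span_mul_span] at h
    refine Submodule.span_mono ?_ h
    rintro _ ⟨_, ⟨l, rfl, rfl⟩, _, ⟨l', rfl, rfl⟩, rfl⟩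
    exact ⟨l ++ l', by simp, by simp⟩

/-- The subalgebra `D_0` of elements of degree zero. -/
noncomputable def degZero (d : Fin (n + 1) → ℕ) : Subalgebra K (Weyl K n) :=
  SetLike.GradeZero.subalgebra (weylPart K d)

theorem mem_degZero (d : Fin (n + 1) → ℕ) (a : Weyl K n) :
    a ∈ degZero K d ↔ a ∈ weylPart K d 0 := Iff.rfl

/-- The Euler field `E = ∑ d_i x_i ∂_i`. -/
noncomputable def euler (d : Fin (n + 1) → ℕ) : Weyl K n :=
  ∑ i, (d i : Weyl K n) * (x K i * dd K i)

theorem euler_mul_x (d : Fin (n + 1) → ℕ) (j : Fin (n + 1)) :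
    euler K d * x K j = x K j * euler K d + (d j : Weyl K n) * x K j := by
  have h : ∀ i, (d i : Weyl K n) * (x K i * dd K i) * x K j =
      x K j * ((d i : Weyl K n) * (x K i * dd K i)) +
        if i = j then (d j : Weyl K n) * x K j else 0 := by
    intro i
    have hc : x K j * (d i : Weyl K n) = (d i : Weyl K n) * x K j :=
      ((Nat.cast_commute (d i) (x K j)).eq).symm
    rw [mul_assoc, mul_assoc, dd_mul_x, ← mul_assoc (x K j), hc, mul_assoc, ← mul_assoc (x K j),
      x_mul_x K j i, mul_add, mul_add, mul_assoc]
    split_ifs with hij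
    · subst hij; simp
    · simp
  rw [euler, Finset.sum_mul, Finset.mul_sum, Finset.sum_congr rfl fun i _ => h i,
    Finset.sum_add_distrib]
  simp

theorem euler_mul_dd (d : Fin (n + 1) → ℕ) (j : Fin (n + 1)) :
    euler K d * dd K j = dd K j * euler K d - (d j : Weyl K n) * dd K j := by
  have h : ∀ i, (d i : Weyl K n) * (x K i * dd K i) * dd K j =
      dd K j * ((d i : Weyl K n) * (x K i * dd K i)) -
        if i = j then (d j : Weyl K n) * dd K j else 0 := by
    intro i
    have hc : dd K j * (d i : Weyl K n) = (d i : Weyl K n) * dd K j :=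
      ((Nat.cast_commute (d i) (dd K j)).eq).symm
    rw [mul_assoc, mul_assoc, dd_mul_dd K i j, ← mul_assoc (dd K j), hc, mul_assoc,
      ← mul_assoc (dd K j), dd_mul_x, add_mul, mul_add, mul_assoc]
    split_ifs with hij hji hji
    · subst hij; simp
    · exact absurd hij.symm hji
    · exact absurd hji.symm hij
    · simp
  rw [euler, Finset.sum_mul, Finset.mul_sum, Finset.sum_congr rfl fun i _ => h i,
    Finset.sum_sub_distrib]
  simp

theorem euler_mul_gen (d : Fin (n + 1) → ℕ) (s : Fin (n + 1) ⊕ Fin (n + 1)) :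
    euler K d * gen K s = gen K s * euler K d + (genDeg d s : Weyl K n) * gen K s := by
  rcases s with j | j
  · simpa [genDeg, x] using euler_mul_x K d j
  · simpa [genDeg, dd, sub_eq_add_neg, neg_mul] using euler_mul_dd K d j

theorem euler_mul_of_mem (d : Fin (n + 1) → ℕ) (k : ℤ) {a : Weyl K n}
    (ha : a ∈ weylPart K d k) :
    euler K d * a = a * euler K d + (k : Weyl K n) * a := by
  induction ha using Submodule.span_induction with
  | mem w hw =>
    obtain ⟨l, rfl, rfl⟩ := hw
    induction l with
    | nil => simp
    | cons s l ih =>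
      simp only [List.map_cons, List.prod_cons, List.sum_cons]
      have hc := (Int.cast_commute (l.map (genDeg d)).sum (gen K s)).eq
      rw [← mul_assoc, euler_mul_gen, add_mul, mul_assoc, ih, mul_add, ← mul_assoc (gen K s),
        ← mul_assoc (gen K s), ← hc]
      push_cast
      noncomm_ring
  | zero => simp
  | add a b _ _ ha hb => rw [mul_add, ha, hb]; noncomm_ring
  | smul c a _ ha => rw [mul_smul_comm, ha, smul_add, smul_mul_assoc, mul_smul_comm]

theorem euler_mem (d : Fin (n + 1) → ℕ) : euler K d ∈ degZero K d := by
  refine sum_mem fun i _ => mul_mem (natCast_mem _ _) ?_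
  exact Submodule.subset_span ⟨[Sum.inl i, Sum.inr i], by simp [genDeg], by simp [x, dd]⟩

/-- The Euler field as an element of `D_0`. -/
noncomputable def eulerZero (d : Fin (n + 1) → ℕ) : degZero K d := ⟨euler K d, euler_mem K d⟩

theorem eulerZero_comm (d : Fin (n + 1) → ℕ) (a : degZero K d) :
    eulerZero K d * a = a * eulerZero K d := by
  apply Subtype.ext
  simpa [eulerZero] using euler_mul_of_mem K d 0 a.2

end Algebra

section Twist

variable {K : Type u} [Field K] {n : ℕ} (d : Fin (n + 1) → ℕ) (lam : K)

/-- The element `E - λ` of `D_0`. -/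
noncomputable def eulerSub : degZero K d := eulerZero K d - algebraMap K _ lam

theorem eulerSub_comm (a : degZero K d) : eulerSub d lam * a = a * eulerSub d lam := by
  rw [eulerSub, sub_mul, mul_sub, eulerZero_comm, Algebra.commutes]

/-- The left ideal `D_0 (E - λ)`; it is two-sided since `E` is central in `D_0`. -/
noncomputable def twistIdeal : Ideal (degZero K d) := Ideal.span {eulerSub d lam}

instance twistIdeal_isTwoSided : (twistIdeal d lam).IsTwoSided where
  mul_mem_of_left {a} b ha := by
    obtain ⟨c, rfl⟩ := Ideal.mem_span_singleton'.1 ha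
    rw [mul_assoc, eulerSub_comm, ← mul_assoc]
    exact Ideal.mem_span_singleton'.2 ⟨_, rfl⟩

/-- The algebra `D_0 / D_0 (E - λ)` of global twisted differential operators. -/
abbrev TwistedOps : Type u := degZero K d ⧸ twistIdeal d lam

end Twist

/-! ### Weight spaces, Euler modules and torsion -/

section Modules

variable {K : Type u} [Field K] {n : ℕ} (d : Fin (n + 1) → ℕ)

/-- The `μ`-eigenspace `M^μ` of the Euler field on a `D`-module `M`, as a `D_0`-submodule. -/
noncomputable def weightSpace (M : Type u) [AddCommGroup M] [Module (Weyl K n) M] (μ : K) :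
    Submodule (degZero K d) M where
  carrier := {m | euler K d • m = algebraMap K (Weyl K n) μ • m}
  zero_mem' := by simp
  add_mem' {a b} ha hb := by
    simp only [Set.mem_ofPred_eq] at ha hb ⊢
    rw [smul_add, smul_add, ha, hb]
  smul_mem' c m hm := by
    simp only [Set.mem_ofPred_eq] at hm ⊢
    have h : euler K d * (c : Weyl K n) = c * euler K d :=
      congrArg Subtype.val (eulerZero_comm K d c)
    rw [Subalgebra.smul_def, ← mul_smul, h, mul_smul, hm, ← mul_smul, ← mul_smul,
      Algebra.commutes]

theorem mem_weightSpace {M : Type u} [AddCommGroup M] [Module (Weyl K n) M] {μ : K} {m : M} :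
    m ∈ weightSpace d M μ ↔ euler K d • m = algebraMap K (Weyl K n) μ • m := Iff.rfl

/-- `M` is `λ`-Euler: it is the sum of the eigenspaces `M^(λ + k)`, `k ∈ ℤ`.  (The sum is
automatically direct in characteristic zero; its `k`-th summand is the canonical degree `k`
part of `M`.) -/
def IsEuler (lam : K) (M : Type u) [AddCommGroup M] [Module (Weyl K n) M] : Prop :=
  ⨆ k : ℤ, weightSpace d M (lam + k) = ⊤

/-- `M` is torsion as a module over the graded ring `A = K[x_0, …, x_n]`: every element is
annihilated by `A_k` for all sufficiently large `k`. -/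
def IsTorsionModule (M : Type u) [AddCommGroup M] [Module (Weyl K n) M] : Prop :=
  ∀ m : M, ∃ N : ℕ, ∀ k > N, ∀ a ∈ polyPart K d k, a • m = 0

/-- On `M^λ` the ideal `D_0 (E - λ)` acts by zero. -/
theorem isTorsionBySet_weightSpace (M : Type u) [AddCommGroup M] [Module (Weyl K n) M] (lam : K) :
    Module.IsTorsionBySet (degZero K d) (weightSpace d M lam) (twistIdeal d lam) := by
  rintro ⟨m, hm⟩ ⟨a, ha⟩
  obtain ⟨c, rfl⟩ := Ideal.mem_span_singleton'.1 ha
  apply Subtype.ext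
  change ((c * eulerSub d lam : degZero K d) : Weyl K n) • m = 0
  have h : ((eulerSub d lam : degZero K d) : Weyl K n) • m = 0 := by
    change (euler K d - algebraMap K (Weyl K n) lam) • m = 0
    rw [sub_smul, (mem_weightSpace d).1 hm, sub_self]
  rw [Subalgebra.coe_mul, mul_smul, h, smul_zero]

/-- The `D_0 / D_0 (E - λ)`-module structure on `M^λ` induced by the action of `D_0`. -/
noncomputable instance weightSpaceModule (M : Type u) [AddCommGroup M] [Module (Weyl K n) M]
    (lam : K) : Module (TwistedOps d lam) (weightSpace d M lam) :=
  (isTorsionBySet_weightSpace d M lam).module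

theorem mk_smul_weightSpace (M : Type u) [AddCommGroup M] [Module (Weyl K n) M] (lam : K)
    (a : degZero K d) (m : weightSpace d M lam) :
    (Ideal.Quotient.mk (twistIdeal d lam) a) • m = a • m := rfl

/-- The map `M^λ → N^λ` induced by a homomorphism `M → N` of `D`-modules. -/
noncomputable def weightMap (lam : K) {M N : Type u} [AddCommGroup M] [Module (Weyl K n) M] [AddCommGroup N]
    [Module (Weyl K n) N] (f : M →ₗ[Weyl K n] N) :
    weightSpace d M lam →ₗ[TwistedOps d lam] weightSpace d N lam where
  toFun m := ⟨f m, by rw [mem_weightSpace, ← map_smul, (mem_weightSpace d).1 m.2, map_smul]⟩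
  map_add' a b := by ext; simp
  map_smul' a m := by
    obtain ⟨a, rfl⟩ := Ideal.Quotient.mk_surjective a
    apply Subtype.ext
    change f ((a : Weyl K n) • (m : M)) = (a : Weyl K n) • f m
    exact map_smul f _ _

end Modules

/-! ### The categories and the functors -/

section Categories

variable {K : Type u} [Field K] {n : ℕ} (d : Fin (n + 1) → ℕ) (lam : K)

/-- The category of `λ`-Euler `D`-modules.  A `D`-linear map preserves the eigenspaces of the
Euler field, so this is a full subcategory both of all `D`-modules and, through the canonical
grading, of all graded `D`-modules. -/
abbrev EulerMod : Type (u + 1) :=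
  ObjectProperty.FullSubcategory (C := ModuleCat.{u} (Weyl K n)) (fun M => IsEuler d lam M)

/-- The homomorphisms of `λ`-Euler modules whose kernel and cokernel are torsion. -/
def isoModTorsion : MorphismProperty (EulerMod d lam) := fun _ N f =>
  IsTorsionModule (K := K) d (LinearMap.ker f.hom.hom) ∧
    IsTorsionModule (K := K) d (N.obj ⧸ LinearMap.range f.hom.hom)

/-- The category of `λ`-twisted D-modules on the weighted projective stack: the Serre quotient
of the category of `λ`-Euler `D`-modules by its full subcategory of torsion modules, i.e. its
localization at the homomorphisms with torsion kernel and cokernel. -/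
abbrev TwistedDMod : Type (u + 1) := (isoModTorsion d lam).Localization

/-- The quotient functor `π_λ`. -/
noncomputable abbrev quotientFunctor : EulerMod d lam ⥤ TwistedDMod d lam := (isoModTorsion d lam).Q

/-- The functor `M ↦ M_0 = M^λ` taking a `λ`-Euler module to its part of degree zero. -/
noncomputable def degZeroFunctor : EulerMod d lam ⥤ ModuleCat.{u} (TwistedOps d lam) where
  obj M := ModuleCat.of _ (weightSpace d M.obj lam)
  map f := ModuleCat.ofHom (weightMap d lam f.hom.hom)

/-- The global sections functor `Γ_λ(𝓜) = ω(𝓜)_0`, where `ω` is the section functor, i.e. a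
right adjoint of the quotient functor. -/
noncomputable def globalSections (ω : TwistedDMod d lam ⥤ EulerMod d lam)
    (_ : quotientFunctor d lam ⊣ ω) :
    TwistedDMod d lam ⥤ ModuleCat.{u} (TwistedOps d lam) :=
  ω ⋙ degZeroFunctor d lam

/-- The semigroup `𝒜`, i.e. the `ℤ_{≥ 0}`-span of the weights, inside `K`. -/
def weightSemigroup (K : Type u) [Field K] {n : ℕ} (d : Fin (n + 1) → ℕ) : AddSubmonoid K :=
  AddSubmonoid.closure (Set.range fun i => (d i : K))

end Categories

end WeightedDMod

/-! The functor `F : M ↦ M^λ` is exact on `λ`-Euler modules and has a right adjoint, sending `N` to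
the largest `λ`-Euler submodule of the coinduced module `Hom_{D_0}(D, N)`. The counit is evaluation
at `1`. It is bijective because `E` acts on `N` by `λ`, so that a homomorphism of weight `λ` from
`D` to `N` vanishes on all components of `D` except `D_0`. Hence `F` is a localization at the
morphisms it inverts. By exactness these are the morphisms inverted by `π_λ`, provided that a
`λ`-Euler module `M` is torsion if and only if `M^λ = 0`; then `Γ_λ` is the equivalence between two
localizations at the same morphisms.

If `M` is torsion and `0 ≠ m ∈ M^λ`, some monomial in the `x_i` sends `m` to a nonzero element
killed by every `x_i`. On it `E` acts by `-∑ d_i`, so `λ` is a negative integer, which is excluded.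

Conversely let `M^λ = 0`. If every `d_i` divides `k ≥ 0`, the `∂_i` act nilpotently on `M^(λ + k)`,
so a nonzero element of it yields one killed by every `∂_i`, hence of weight `0`. For `λ ∉ ℤ` there
is none, and for `λ ∈ 𝒜` a monomial in the `x_i` moves it injectively into `M^λ = 0`; thus
`M^(λ + k) = 0`. As `∂_i x_i - x_i ∂_i = 1`, the weights `μ` with `M^μ = 0` form a convex subset of
every progression of step `d_i`, and `gcd(d_0, …, d_n) = 1` then gives `M^(λ + k) = 0` for all
large `k`. -/

namespace WeightedDMod

section CanonicalPair

variable {R M : Type*} [Ring R] [AddCommGroup M] [Module R M]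

theorem pow_succ_mul_of_mul_eq_mul_add_one {p q : R} (h : q * p = p * q + 1) (b : ℕ) :
    q ^ (b + 1) * p = p * q ^ (b + 1) + (b + 1) • q ^ b := by
  induction b with
  | zero => simpa using h
  | succ b ih =>
    calc q ^ (b + 2) * p = q * (q ^ (b + 1) * p) := by rw [pow_succ' q (b + 1), mul_assoc]
      _ = (q * p) * q ^ (b + 1) + (b + 1) • q ^ (b + 1) := by
        rw [ih, mul_add, mul_smul_comm, mul_assoc, pow_succ' q b]
      _ = p * q ^ (b + 2) + (b + 2) • q ^ (b + 1) := by
        rw [h, add_mul, mul_assoc, ← pow_succ', one_mul, add_assoc, ← succ_nsmul']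

theorem pow_succ_smul_smul {p q : R} (h : q * p = p * q + 1) (b : ℕ) (m : M) :
    q ^ (b + 1) • p • m = p • q ^ (b + 1) • m + (b + 1) • q ^ b • m := by
  rw [← mul_smul, pow_succ_mul_of_mul_eq_mul_add_one h, add_smul, mul_smul, smul_assoc]

theorem eq_zero_of_smul_eq_zero_of_pow_smul_eq_zero [IsAddTorsionFree M] {p q : R}
    (h : q * p = p * q + 1) {m : M} (hp : p • m = 0) {b : ℕ} (hq : q ^ b • m = 0) : m = 0 := by
  induction b with
  | zero => simpa using hq
  | succ b ih =>
    have key := pow_succ_smul_smul h b m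
    rw [hp, hq, smul_zero, smul_zero, zero_add] at key
    exact ih ((nsmul_eq_zero_iff_right b.succ_ne_zero).1 key.symm)

variable {ι : Type*}

theorem exists_pow_smul_smul_eq_zero [DecidableEq ι] {p q : ι → R}
    (h : ∀ i j, q i * p j = p j * q i + if i = j then 1 else 0) {m : M}
    (hm : ∀ i, ∃ b, q i ^ b • m = 0) (i j : ι) : ∃ b, q i ^ b • p j • m = 0 := by
  obtain ⟨b, hb⟩ := hm i
  rcases eq_or_ne i j with rfl | hij
  · refine ⟨b + 1, ?_⟩
    rw [pow_succ_smul_smul (by simpa using h i i), pow_succ', mul_smul, hb]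
    simp only [smul_zero, add_zero]
  · have hcomm : Commute (q i) (p j) := by simpa [hij, Commute, SemiconjBy] using h i j
    exact ⟨b, by rw [← mul_smul, (hcomm.pow_left b).eq, mul_smul, hb, smul_zero]⟩

theorem prod_smul_ne_zero [IsAddTorsionFree M] [DecidableEq ι] {p q : ι → R}
    (h : ∀ i j, q i * p j = p j * q i + if i = j then 1 else 0) {m : M} (hm : m ≠ 0)
    (hnil : ∀ i, ∃ b, q i ^ b • m = 0) (l : List ι) : (l.map p).prod • m ≠ 0 := by
  induction l using List.reverseRecOn generalizing m with
  | nil => simpa using hm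
  | append_singleton l j ih =>
    obtain ⟨b, hb⟩ := hnil j
    have hjm : p j • m ≠ 0 := fun hp =>
      hm (eq_zero_of_smul_eq_zero_of_pow_smul_eq_zero (by simpa using h j j) hp hb)
    simpa [mul_smul] using ih hjm fun i => exists_pow_smul_smul_eq_zero h hnil i j

end CanonicalPair

section CommonKernel

variable {R M : Type*} [Ring R] [AddCommGroup M] [Module R M]

theorem exists_pow_smul_ne_zero_and_smul_eq_zero {a : R} {m : M} (hm : m ≠ 0)
    (ha : ∃ b, a ^ b • m = 0) : ∃ c, a ^ c • m ≠ 0 ∧ a • a ^ c • m = 0 := by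
  classical
  obtain ⟨c, hc⟩ := Nat.exists_eq_add_one_of_ne_zero
    (show Nat.find ha ≠ 0 from fun h0 => hm (by simpa [h0] using Nat.find_spec ha))
  refine ⟨c, Nat.find_min ha (by lia), ?_⟩
  rw [← mul_smul, ← pow_succ', ← hc]
  exact Nat.find_spec ha

theorem exists_prod_smul_ne_zero_and_forall_smul_eq_zero {ι : Type*} (s : Finset ι) {g : ι → R}
    (hg : ∀ i j, Commute (g i) (g j)) {m : M} (hm : m ≠ 0)
    (hnil : ∀ i ∈ s, ∃ b, g i ^ b • m = 0) :
    ∃ l : List ι, (l.map g).prod • m ≠ 0 ∧ ∀ i ∈ s, g i • (l.map g).prod • m = 0 := by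
  classical
  induction s using Finset.induction_on with
  | empty => exact ⟨[], by simpa using hm, by simp⟩
  | insert i s _ ih =>
    obtain ⟨l, hne, hkill⟩ := ih fun j hj => hnil j (Finset.mem_insert_of_mem hj)
    have hnil' : ∃ b, g i ^ b • (l.map g).prod • m = 0 := by
      obtain ⟨b, hb⟩ := hnil i (Finset.mem_insert_self i s)
      have hcomm : Commute (g i) (l.map g).prod :=
        Commute.list_prod_right _ _ (List.forall_mem_map.2 fun j _ => hg i j)
      exact ⟨b, by rw [← mul_smul, (hcomm.pow_left b).eq, mul_smul, hb, smul_zero]⟩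
    obtain ⟨c, hc, hic⟩ := exists_pow_smul_ne_zero_and_smul_eq_zero hne hnil'
    refine ⟨List.replicate c i ++ l, ?_⟩
    rw [List.map_append, List.map_replicate, List.prod_append, List.prod_replicate, mul_smul]
    refine ⟨hc, Finset.forall_mem_insert .. |>.2 ⟨hic, fun j hj => ?_⟩⟩
    rw [← mul_smul, ((hg j i).pow_right c).eq, mul_smul, hkill j hj, smul_zero]

end CommonKernel

section Numerical

open Filter

variable {ι : Type*} {Z : Set ℤ}

theorem exists_sum_mul_eq_one_of_gcd_eq_one {s : Finset ι} {d : ι → ℕ} (hgcd : s.gcd d = 1) :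
    ∃ c : ι → ℤ, ∑ i ∈ s, c i * d i = 1 := by
  obtain ⟨c, hc⟩ := s.gcd_eq_sum_mul fun i => (d i : ℤ)
  have hdvd : (s.gcd fun i => (d i : ℤ)).natAbs ∣ 1 := hgcd ▸ Finset.dvd_gcd fun i hi =>
    Int.natAbs_dvd_natAbs.2 (Finset.gcd_dvd (f := fun i => (d i : ℤ)) hi)
  have hunit : IsUnit (s.gcd fun i => (d i : ℤ)) := Int.isUnit_iff_natAbs_eq.2 (Nat.dvd_one.1 hdvd)
  refine ⟨c, ?_⟩
  simp only [mul_comm (c _), ← hc]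
  rw [← Finset.normalize_gcd, normalize_eq_one.2 hunit]

theorem eventually_add_mul_mem_of_dvd {L e : ℕ} (hL : L ≠ 0) (he : e ∣ L)
    (hconv : ∀ k a b : ℤ, 0 ≤ a → 0 ≤ b → k - a * e ∈ Z → k + b * e ∈ Z → k ∈ Z) {k : ℤ}
    (hk : ∀ᶠ r : ℤ in atTop, k + r * L ∈ Z) (c : ℤ) :
    ∀ᶠ r : ℤ in atTop, k + c * e + r * L ∈ Z := by
  obtain ⟨q, rfl⟩ := he
  have hq : (1 : ℤ) ≤ q := mod_cast Nat.one_le_iff_ne_zero.2 (right_ne_zero_of_mul hL)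
  have hcq : |c| ≤ |c| * q := le_mul_of_one_le_right (abs_nonneg c) hq
  have hlow := (tendsto_atTop_add_const_right atTop (-|c|) tendsto_id).eventually hk
  have hup := (tendsto_atTop_add_const_right atTop |c| tendsto_id).eventually hk
  filter_upwards [hlow, hup] with r hlow hup
  refine hconv _ (|c| * q + c) (|c| * q - c) (by linarith [neg_abs_le c])
    (by linarith [le_abs_self c]) ?_ ?_
  · convert hlow using 1
    push_cast [id]
    ring
  · convert hup using 1
    push_cast [id]
    ring

theorem eventually_mem_of_eventually_add_mul_mem {L : ℕ} (hL : L ≠ 0)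
    (h : ∀ k : ℤ, ∀ᶠ r : ℤ in atTop, k + r * L ∈ Z) : ∀ᶠ k in atTop, k ∈ Z := by
  have hL' : (0 : ℤ) < L := by exact_mod_cast Nat.pos_of_ne_zero hL
  have hres : ∀ᶠ r : ℤ in atTop, ∀ s ∈ Finset.Ico 0 (L : ℤ), s + r * L ∈ Z :=
    (Filter.eventually_all_finset _).2 fun s _ => h s
  obtain ⟨R, hR⟩ := eventually_atTop.1 hres
  filter_upwards [eventually_ge_atTop (R * L)] with k hk
  have hmod := hR (k / L) ((Int.le_ediv_iff_mul_le hL').2 hk) (k % L)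
    (Finset.mem_Ico.2 ⟨Int.emod_nonneg k hL'.ne', Int.emod_lt_of_pos k hL'⟩)
  rwa [Int.emod_add_ediv_mul] at hmod

theorem eventually_mem_of_gcd_eq_one [Fintype ι] {d : ι → ℕ} (hd : ∀ i, 0 < d i)
    (hgcd : Finset.univ.gcd d = 1) (hdvd : ∀ k : ℕ, (∀ i, d i ∣ k) → (k : ℤ) ∈ Z)
    (hconv : ∀ i, ∀ k a b : ℤ, 0 ≤ a → 0 ≤ b → k - a * d i ∈ Z → k + b * d i ∈ Z → k ∈ Z) :
    ∀ᶠ k in atTop, k ∈ Z := by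
  set L := ∏ i, d i
  have hdL (i) : d i ∣ L := Finset.dvd_prod_of_mem d (Finset.mem_univ i)
  have hL : L ≠ 0 := Finset.prod_ne_zero_iff.2 fun i _ => (hd i).ne'
  have hcomb (c : ι → ℤ) (s : Finset ι) :
      ∀ᶠ r : ℤ in atTop, ∑ i ∈ s, c i * d i + r * L ∈ Z := by
    classical
    induction s using Finset.induction_on with
    | empty =>
      filter_upwards [eventually_ge_atTop 0] with r hr
      lift r to ℕ using hr
      simpa using hdvd (r * L) fun i => (hdL i).mul_left r
    | insert i s hi ih =>
      simp only [Finset.sum_insert hi, add_comm (c i * _)]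
      exact eventually_add_mul_mem_of_dvd hL (hdL i) (hconv i) ih (c i)
  obtain ⟨c, hc⟩ := exists_sum_mul_eq_one_of_gcd_eq_one hgcd
  refine eventually_mem_of_eventually_add_mul_mem hL fun k => ?_
  have hk : ∑ i, k * c i * d i = k := by simp only [mul_assoc, ← Finset.mul_sum, hc, mul_one]
  simpa only [hk] using hcomb (fun i => k * c i) Finset.univ

end Numerical

section Weights

variable {K : Type u} [Field K] {n : ℕ} (d : Fin (n + 1) → ℕ)
  {M : Type u} [AddCommGroup M] [Module (Weyl K n) M]

theorem isAddTorsionFree (K : Type u) [Field K] [CharZero K] (n : ℕ) (M : Type u)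
    [AddCommGroup M] [Module (Weyl K n) M] : IsAddTorsionFree M :=
  let _ : Module K M := Module.compHom M (algebraMap K (Weyl K n))
  .of_isTorsionFree K M

variable (K M) in
theorem iSupIndep_weightSpace : iSupIndep fun μ : K => weightSpace d M μ := by
  let _ : Module K M := Module.compHom M (algebraMap K (Weyl K n))
  have : IsScalarTower K (Weyl K n) M := .of_algebraMap_smul fun _ _ => rfl
  have h := (Algebra.lsmul K K M (euler K d)).eigenspaces_iSupIndep
  rw [iSupIndep_iff_finsetSum_eq_zero_imp_eq_zero] at h ⊢
  exact fun s v hv => h s v fun μ hμ => Module.End.mem_eigenspace_iff.2 (hv μ hμ)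

theorem eq_of_mem_weightSpace {μ ν : K} {m : M} (hm : m ≠ 0) (hμ : m ∈ weightSpace d M μ)
    (hν : m ∈ weightSpace d M ν) : μ = ν := by
  by_contra hne
  exact hm (Submodule.disjoint_def.1 ((iSupIndep_weightSpace K d M).pairwiseDisjoint hne) m hμ hν)

theorem smul_mem_weightSpace {k : ℤ} {a : Weyl K n} (ha : a ∈ weylPart K d k) {μ : K} {m : M}
    (hm : m ∈ weightSpace d M μ) : a • m ∈ weightSpace d M (μ + k) := by
  rw [mem_weightSpace] at hm ⊢
  calc euler K d • a • m = a • euler K d • m + (k : Weyl K n) • a • m := by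
        rw [← mul_smul, euler_mul_of_mem K d k ha, add_smul, mul_smul, mul_smul]
    _ = algebraMap K (Weyl K n) (μ + k) • a • m := by
        rw [hm, ← mul_smul a, ← Algebra.commutes, mul_smul, map_add, add_smul, map_intCast]

theorem map_mem_weightSpace {N : Type u} [AddCommGroup N] [Module (Weyl K n) N]
    (f : M →ₗ[Weyl K n] N) {μ : K} {m : M} (hm : m ∈ weightSpace d M μ) :
    f m ∈ weightSpace d N μ := by
  rw [mem_weightSpace] at hm ⊢
  rw [← map_smul, hm, map_smul]

theorem prod_map_x_mem_polyPart (l : List (Fin (n + 1))) :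
    (l.map (x K)).prod ∈ polyPart K d (l.map d).sum :=
  Submodule.subset_span ⟨l, rfl, rfl⟩

theorem polyPart_le_weylPart (k : ℕ) : polyPart (n := n) K d k ≤ weylPart K d k := by
  refine Submodule.span_le.2 ?_
  rintro _ ⟨l, rfl, rfl⟩
  refine Submodule.subset_span ⟨l.map Sum.inl, ?_, by rw [List.map_map]; rfl⟩
  induction l <;> simp_all [genDeg]

theorem prod_map_dd_mem_weylPart (l : List (Fin (n + 1))) :
    (l.map (dd K)).prod ∈ weylPart K d (-((l.map d).sum : ℕ)) := by
  refine Submodule.subset_span ⟨l.map Sum.inr, ?_, by rw [List.map_map]; rfl⟩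
  induction l <;> simp_all [genDeg, add_comm]

theorem prod_map_x_smul_mem_weightSpace (l : List (Fin (n + 1))) {μ : K} {m : M}
    (hm : m ∈ weightSpace d M μ) :
    (l.map (x K)).prod • m ∈ weightSpace d M (μ + (l.map d).sum) := by
  have := smul_mem_weightSpace d (polyPart_le_weylPart d _ (prod_map_x_mem_polyPart d l)) hm
  rwa [Int.cast_natCast] at this

theorem prod_map_dd_smul_mem_weightSpace (l : List (Fin (n + 1))) {μ : K} {m : M}
    (hm : m ∈ weightSpace d M μ) :
    (l.map (dd K)).prod • m ∈ weightSpace d M (μ - (l.map d).sum) := by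
  have := smul_mem_weightSpace d (prod_map_dd_mem_weylPart d l) hm
  rwa [Int.cast_neg, Int.cast_natCast, ← sub_eq_add_neg] at this

theorem x_smul_mem_weightSpace (i : Fin (n + 1)) {μ : K} {m : M} (hm : m ∈ weightSpace d M μ) :
    x K i • m ∈ weightSpace d M (μ + d i) := by
  simpa using prod_map_x_smul_mem_weightSpace d [i] hm

theorem dd_pow_smul_mem_weightSpace (i : Fin (n + 1)) (b : ℕ) {μ : K} {m : M}
    (hm : m ∈ weightSpace d M μ) : dd K i ^ b • m ∈ weightSpace d M (μ - b * d i) := by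
  simpa using prod_map_dd_smul_mem_weightSpace d (List.replicate b i) hm

theorem mem_weightSpace_of_x_smul_eq_zero {m : M} (hm : ∀ i : Fin (n + 1), x K i • m = 0) :
    m ∈ weightSpace d M (-(∑ i, d i : ℕ) : K) := by
  have hi (i : Fin (n + 1)) : (x K i * dd K i) • m = -m := by
    rw [show x K i * dd K i = dd K i * x K i - 1 by simp [dd_mul_x], sub_smul, mul_smul, hm i]
    simp
  simp only [mem_weightSpace, euler, Finset.sum_smul, mul_smul _ (x K _ * dd K _), hi]
  simp [Finset.sum_smul]

theorem mem_weightSpace_zero_of_dd_smul_eq_zero {m : M}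
    (hm : ∀ i : Fin (n + 1), dd K i • m = 0) : m ∈ weightSpace d M (0 : K) := by
  simp [mem_weightSpace, euler, Finset.sum_smul, mul_smul, hm]

end Weights

section Torsion

variable {K : Type u} [Field K] {n : ℕ} {d : Fin (n + 1) → ℕ} {lam : K}
  {M : Type u} [AddCommGroup M] [Module (Weyl K n) M]

theorem exists_natCast_eq_of_mem_weightSemigroup (h : lam ∈ weightSemigroup K d) :
    ∃ l : List (Fin (n + 1)), lam = (l.map d).sum := by
  induction h using AddSubmonoid.closure_induction with
  | mem _ hi =>
    obtain ⟨i, rfl⟩ := hi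
    exact ⟨[i], by simp⟩
  | zero => exact ⟨[], by simp⟩
  | add _ _ _ _ h h' =>
    obtain ⟨l, rfl⟩ := h
    obtain ⟨l', rfl⟩ := h'
    exact ⟨l ++ l', by simp⟩

theorem weightSpace_eq_bot_of_isTorsionModule (hd : ∀ i, 0 < d i)
    (hlam : ∀ k : ℕ, k ≠ 0 → lam ≠ -k) (hM : IsTorsionModule (K := K) d M) :
    weightSpace d M lam = ⊥ := by
  refine (Submodule.eq_bot_iff _).2 fun m hm => by_contra fun hm0 => ?_
  obtain ⟨N, hN⟩ := hM m
  have hnil (i : Fin (n + 1)) : x K i ^ (N + 1) • m = 0 := by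
    refine hN ((N + 1) * d i) (Nat.le_mul_of_pos_right _ (hd i)) _ ?_
    simpa using prod_map_x_mem_polyPart (K := K) d (List.replicate (N + 1) i)
  obtain ⟨l, hne, hkill⟩ := exists_prod_smul_ne_zero_and_forall_smul_eq_zero Finset.univ
    (x_mul_x K) hm0 fun i _ => ⟨N + 1, hnil i⟩
  have hweight := eq_of_mem_weightSpace d hne (prod_map_x_smul_mem_weightSpace d l hm)
    (mem_weightSpace_of_x_smul_eq_zero d fun i => hkill i (Finset.mem_univ i))
  have hpos : 0 < ∑ i, d i := Finset.sum_pos (fun i _ => hd i) Finset.univ_nonempty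
  refine hlam ((l.map d).sum + ∑ i, d i) (by lia) ?_
  rw [eq_sub_of_add_eq hweight]
  push_cast
  ring

theorem weightSpace_eq_bot_of_add_of_sub [CharZero K] (i : Fin (n + 1)) (a b : ℕ) {μ : K}
    (hsub : weightSpace d M (μ - a * d i) = ⊥) (hadd : weightSpace d M (μ + b * d i) = ⊥) :
    weightSpace d M μ = ⊥ := by
  have := isAddTorsionFree K n M
  induction b generalizing a μ with
  | zero => simpa using hadd
  | succ b ih =>
    have hnext : weightSpace d M (μ + d i) = ⊥ := by
      refine ih (a + 1) ?_ ?_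
      · convert hsub using 2
        push_cast
        ring
      · convert hadd using 2
        push_cast
        ring
    refine (Submodule.eq_bot_iff _).2 fun m hm => ?_
    have hx := x_smul_mem_weightSpace d i hm
    have hdd := dd_pow_smul_mem_weightSpace d i a hm
    rw [hnext, Submodule.mem_bot] at hx
    rw [hsub, Submodule.mem_bot] at hdd
    exact eq_zero_of_smul_eq_zero_of_pow_smul_eq_zero (by simpa using dd_mul_x K i i) hx hdd

theorem weightSpace_add_eq_bot_of_forall_dvd [CharZero K]
    (hlam : lam ∉ Set.range (Int.cast : ℤ → K) ∨ lam ∈ weightSemigroup K d)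
    (h : weightSpace d M lam = ⊥) {k : ℕ} (hk : ∀ i, d i ∣ k) :
    weightSpace d M (lam + k) = ⊥ := by
  have := isAddTorsionFree K n M
  refine (Submodule.eq_bot_iff _).2 fun m hm => by_contra fun hm0 => ?_
  have hnil (i : Fin (n + 1)) : dd K i ^ (k / d i) • m = 0 := by
    have hmem := dd_pow_smul_mem_weightSpace d i (k / d i) hm
    rwa [← Nat.cast_mul, Nat.div_mul_cancel (hk i), add_sub_cancel_right, h] at hmem
  obtain ⟨l, hne, hkill⟩ := exists_prod_smul_ne_zero_and_forall_smul_eq_zero Finset.univ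
    (dd_mul_dd K) hm0 fun i _ => ⟨_, hnil i⟩
  set v := (l.map (dd K)).prod • m
  replace hkill (i : Fin (n + 1)) : dd K i • v = 0 := hkill i (Finset.mem_univ i)
  have hv : v ∈ weightSpace d M (0 : K) := mem_weightSpace_zero_of_dd_smul_eq_zero d hkill
  rcases hlam with hnotint | hsemi
  · have hweight := eq_of_mem_weightSpace d hne (prod_map_dd_smul_mem_weightSpace d l hm) hv
    exact hnotint ⟨((l.map d).sum : ℕ) - k, by
      rw [Int.cast_sub, Int.cast_natCast, Int.cast_natCast]
      linear_combination -hweight⟩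
  · obtain ⟨l', rfl⟩ := exists_natCast_eq_of_mem_weightSemigroup hsemi
    have hmem := prod_map_x_smul_mem_weightSpace d l' hv
    rw [zero_add, h] at hmem
    exact prod_smul_ne_zero (dd_mul_x K) hne (fun i => ⟨1, by simpa using hkill i⟩) l' hmem

theorem eventually_weightSpace_add_eq_bot [CharZero K] (hd : ∀ i, 0 < d i)
    (hgcd : Finset.univ.gcd d = 1)
    (hlam : lam ∉ Set.range (Int.cast : ℤ → K) ∨ lam ∈ weightSemigroup K d)
    (h : weightSpace d M lam = ⊥) :
    ∀ᶠ k : ℤ in Filter.atTop, weightSpace d M (lam + k) = ⊥ := by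
  refine eventually_mem_of_gcd_eq_one hd hgcd (Z := {k : ℤ | weightSpace d M (lam + k) = ⊥})
    (fun k hk => ?_) fun i k a b ha hb hsub hadd => ?_
  · simpa using weightSpace_add_eq_bot_of_forall_dvd hlam h hk
  · lift a to ℕ using ha
    lift b to ℕ using hb
    refine weightSpace_eq_bot_of_add_of_sub i a b ?_ ?_
    · simpa [add_sub_assoc] using hsub
    · simpa [add_assoc] using hadd

end Torsion

section EulerModules

variable {K : Type u} [Field K] {n : ℕ} {d : Fin (n + 1) → ℕ} {lam : K}
  {M N : Type u} [AddCommGroup M] [Module (Weyl K n) M] [AddCommGroup N] [Module (Weyl K n) N]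

theorem IsEuler.induction (hM : IsEuler d lam M) {P : M → Prop}
    (weight : ∀ k : ℤ, ∀ m ∈ weightSpace d M (lam + k), P m)
    (add : ∀ m m', P m → P m' → P (m + m')) (m : M) : P m := by
  have hm : m ∈ ⨆ k : ℤ, weightSpace d M (lam + k) := by rw [hM]; trivial
  exact Submodule.iSup_induction _ (motive := P) hm weight (weight 0 0 (zero_mem _)) add

theorem isTorsionModule_of_weightSpace_eq_bot [CharZero K] (hd : ∀ i, 0 < d i)
    (hgcd : Finset.univ.gcd d = 1)
    (hlam : lam ∉ Set.range (Int.cast : ℤ → K) ∨ lam ∈ weightSemigroup K d)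
    (hM : IsEuler d lam M) (h : weightSpace d M lam = ⊥) : IsTorsionModule (K := K) d M := by
  obtain ⟨B, hB⟩ := Filter.eventually_atTop.1
    (eventually_weightSpace_add_eq_bot hd hgcd hlam h)
  intro m
  induction m using hM.induction with
  | weight k m hm =>
    refine ⟨(B - k).toNat, fun j hj a ha => ?_⟩
    have hmem := smul_mem_weightSpace d (polyPart_le_weylPart d j ha) hm
    rwa [add_assoc, ← Int.cast_add, hB _ (by lia)] at hmem
  | add m m' ih ih' =>
    obtain ⟨N, hN⟩ := ih
    obtain ⟨N', hN'⟩ := ih'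
    refine ⟨max N N', fun k hk a ha => ?_⟩
    rw [smul_add, hN k (by lia) a ha, hN' k (by lia) a ha, add_zero]

theorem ne_neg_natCast [CharZero K]
    (hlam : lam ∉ Set.range (Int.cast : ℤ → K) ∨ lam ∈ weightSemigroup K d) {k : ℕ}
    (hk : k ≠ 0) : lam ≠ -k := by
  rintro rfl
  rcases hlam with hnotint | hsemi
  · exact hnotint ⟨-k, by simp⟩
  · obtain ⟨l, hl⟩ := exists_natCast_eq_of_mem_weightSemigroup hsemi
    rw [neg_eq_iff_add_eq_zero] at hl
    norm_cast at hl
    lia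

theorem isTorsionModule_iff [CharZero K] (hd : ∀ i, 0 < d i) (hgcd : Finset.univ.gcd d = 1)
    (hlam : lam ∉ Set.range (Int.cast : ℤ → K) ∨ lam ∈ weightSemigroup K d)
    (hM : IsEuler d lam M) : IsTorsionModule (K := K) d M ↔ weightSpace d M lam = ⊥ :=
  ⟨weightSpace_eq_bot_of_isTorsionModule hd fun _ => ne_neg_natCast hlam,
    isTorsionModule_of_weightSpace_eq_bot hd hgcd hlam hM⟩

end EulerModules

section EulerPart

variable {K : Type u} [Field K] {n : ℕ} (d : Fin (n + 1) → ℕ) (lam : K)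

theorem iSup_weylPart : ⨆ k, weylPart (n := n) K d k = ⊤ := by
  refine Submodule.eq_top_iff'.2 fun a => ?_
  obtain ⟨a, rfl⟩ := RingQuot.mkAlgHom_surjective K (WeylRel K n) a
  change Weyl.mk K n a ∈ _
  induction a using FreeAlgebra.induction with
  | grade0 r =>
    rw [AlgHom.commutes, Algebra.algebraMap_eq_smul_one]
    exact Submodule.smul_mem _ _ (Submodule.mem_iSup_of_mem 0 SetLike.GradedOne.one_mem)
  | grade1 s =>
    exact Submodule.mem_iSup_of_mem (genDeg d s)
      (Submodule.subset_span ⟨[s], by simp, by simp [gen]⟩)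
  | add a b ha hb => rw [map_add]; exact add_mem ha hb
  | mul a b ha hb =>
    rw [map_mul]
    have hmul := Submodule.mul_mem_mul ha hb
    simp only [Submodule.iSup_mul, Submodule.mul_iSup] at hmul
    refine iSup₂_le (fun j i => Submodule.mul_le.2 fun u hu v hv => ?_) hmul
    exact Submodule.mem_iSup_of_mem (i + j) (SetLike.GradedMul.mul_mem hu hv)

variable {d} in
theorem Weyl.induction_weylPart {P : Weyl K n → Prop}
    (homogeneous : ∀ k, ∀ a ∈ weylPart K d k, P a) (add : ∀ a b, P a → P b → P (a + b))
    (a : Weyl K n) : P a :=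
  Submodule.iSup_induction _ (motive := P) (iSup_weylPart (K := K) d ▸ Submodule.mem_top)
    homogeneous (homogeneous 0 0 (zero_mem _)) add

variable {M N : Type u} [AddCommGroup M] [Module (Weyl K n) M] [AddCommGroup N]
  [Module (Weyl K n) N]

theorem smul_mem_iSup_weightSpace (a : Weyl K n) {m : M}
    (hm : m ∈ ⨆ k : ℤ, weightSpace d M (lam + k)) :
    a • m ∈ ⨆ k : ℤ, weightSpace d M (lam + k) := by
  induction a using Weyl.induction_weylPart (d := d) with
  | homogeneous j a ha =>
    induction hm using Submodule.iSup_induction' with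
    | mem k m hm =>
      have hsmul := smul_mem_weightSpace d ha hm
      rw [add_assoc, ← Int.cast_add] at hsmul
      exact Submodule.mem_iSup_of_mem (k + j) hsmul
    | zero => rw [smul_zero]; exact zero_mem _
    | add u v _ _ hu hv => rw [smul_add]; exact add_mem hu hv
  | add a b ha hb => rw [add_smul]; exact add_mem ha hb

variable (M) in
/-- The largest `λ`-Euler submodule of a `D`-module `M`: the sum of the eigenspaces `M^(λ + k)`,
`k ∈ ℤ`. It turns an arbitrary `D`-module into a `λ`-Euler one. -/
noncomputable def eulerPart : Submodule (Weyl K n) M where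
  __ := (⨆ k : ℤ, weightSpace d M (lam + k)).toAddSubmonoid
  smul_mem' := smul_mem_iSup_weightSpace d lam

variable (M) in
theorem isEuler_eulerPart : IsEuler d lam (eulerPart d lam M) := by
  refine Submodule.eq_top_iff'.2 fun ⟨m, hm⟩ => ?_
  induction hm using Submodule.iSup_induction' with
  | mem k m hm => exact Submodule.mem_iSup_of_mem k (Subtype.ext hm)
  | zero => exact zero_mem _
  | add u v _ _ hu hv => exact add_mem hu hv

variable {d lam}

theorem IsEuler.map_mem_eulerPart (hM : IsEuler d lam M) (f : M →ₗ[Weyl K n] N) (m : M) :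
    f m ∈ eulerPart d lam N := by
  induction m using hM.induction with
  | weight k m hm => exact Submodule.mem_iSup_of_mem k (map_mem_weightSpace d f hm)
  | add m m' hm hm' => rw [map_add]; exact add_mem hm hm'

theorem IsEuler.quotient (hM : IsEuler d lam M) (S : Submodule (Weyl K n) M) :
    IsEuler d lam (M ⧸ S) := by
  refine Submodule.eq_top_iff'.2 fun y => ?_
  obtain ⟨m, rfl⟩ := S.mkQ_surjective y
  exact hM.map_mem_eulerPart S.mkQ m

theorem weightMap_injective_iff (f : M →ₗ[Weyl K n] N) :
    Function.Injective (weightMap d lam f) ↔ weightSpace d (LinearMap.ker f) lam = ⊥ := by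
  rw [injective_iff_map_eq_zero, Submodule.eq_bot_iff]
  constructor
  · rintro h ⟨m, hm⟩ hmw
    have hzero := h ⟨m, map_mem_weightSpace d (LinearMap.ker f).subtype hmw⟩ (Subtype.ext hm)
    exact Subtype.ext (Subtype.ext_iff.1 hzero :)
  · rintro h ⟨m, hmw⟩ hm
    have hzero := h ⟨m, congrArg Subtype.val hm⟩ (Subtype.ext hmw)
    exact Subtype.ext (Subtype.ext_iff.1 hzero :)

end EulerPart

section WeightComponents

variable {K : Type u} [Field K] [CharZero K] {n : ℕ} {d : Fin (n + 1) → ℕ} {lam : K}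
  {M N : Type u} [AddCommGroup M] [Module (Weyl K n) M] [AddCommGroup N] [Module (Weyl K n) N]

variable (d lam M) in
theorem iSupIndep_weightSpace_add_intCast :
    iSupIndep fun k : ℤ => weightSpace d M (lam + k) :=
  (iSupIndep_weightSpace K d M).comp ((add_right_injective lam).comp Int.cast_injective)

theorem IsEuler.submodule (hM : IsEuler d lam M) (S : Submodule (Weyl K n) M) :
    IsEuler d lam S := by
  classical
  refine Submodule.eq_top_iff'.2 fun ⟨m, hmS⟩ => ?_
  have hm : m ∈ ⨆ k : ℤ, weightSpace d M (lam + k) := by rw [hM]; trivial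
  obtain ⟨c, hc, rfl⟩ := (Submodule.mem_iSup_iff_exists_finsupp _ _).1 hm
  have hcS (k : ℤ) (hk : k ∈ c.support) : c k ∈ S := by
    have hind := iSupIndep_weightSpace_add_intCast d lam (M ⧸ S)
    rw [iSupIndep_iff_finsetSum_eq_zero_imp_eq_zero] at hind
    refine (Submodule.Quotient.mk_eq_zero S).1 (hind c.support (fun k => S.mkQ (c k))
      (fun k _ => map_mem_weightSpace d S.mkQ (hc k)) ?_ k hk)
    rw [← map_sum]
    exact (Submodule.Quotient.mk_eq_zero S).2 hmS
  have hsum : (⟨c.sum fun _ v => v, hmS⟩ : S) =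
      ∑ k ∈ c.support.attach, ⟨c k, hcS k k.2⟩ := by
    ext
    simp [Finsupp.sum, Finset.sum_attach c.support c]
  rw [hsum]
  exact sum_mem fun k _ => Submodule.mem_iSup_of_mem (k : ℤ) (Subtype.ext (hc k))

variable (d lam M) in
theorem disjoint_weightSpace_iSup_ne :
    Disjoint (weightSpace d M lam) (⨆ (k : ℤ) (_ : k ≠ 0), weightSpace d M (lam + k)) := by
  simpa using iSupIndep_weightSpace_add_intCast d lam M 0

theorem IsEuler.isCompl (hM : IsEuler d lam M) :
    IsCompl (weightSpace d M lam) (⨆ (k : ℤ) (_ : k ≠ 0), weightSpace d M (lam + k)) := by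
  rw [IsEuler, iSup_split_single _ 0, Int.cast_zero, add_zero] at hM
  exact ⟨disjoint_weightSpace_iSup_ne d lam M, codisjoint_iff.2 hM⟩

theorem IsEuler.exists_mem_weightSpace_map_eq (hM : IsEuler d lam M) (f : M →ₗ[Weyl K n] N)
    {m : M} (hm : f m ∈ weightSpace d N lam) : ∃ m' ∈ weightSpace d M lam, f m' = f m := by
  obtain ⟨u, hu, v, hv, rfl⟩ :=
    Submodule.mem_sup.1 (hM.isCompl.sup_eq_top ▸ Submodule.mem_top (x := m))
  refine ⟨u, hu, ?_⟩
  rw [map_add, left_eq_add]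
  have hfv : f v ∈ ⨆ (k : ℤ) (_ : k ≠ 0), weightSpace d N (lam + k) := by
    have hmap : (⨆ (k : ℤ) (_ : k ≠ 0), weightSpace d M (lam + k)) ≤
        (⨆ (k : ℤ) (_ : k ≠ 0), weightSpace d N (lam + k)).comap
          (f.restrictScalars (degZero K d)) :=
      iSup₂_le fun k hk w hw => Submodule.mem_iSup_of_mem k
        (Submodule.mem_iSup_of_mem hk (map_mem_weightSpace d f hw))
    exact hmap hv
  refine Submodule.disjoint_def.1 (disjoint_weightSpace_iSup_ne d lam N) _ ?_ hfv
  rwa [map_add, add_mem_cancel_left (map_mem_weightSpace d f hu)] at hm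

theorem weightMap_surjective_iff (hM : IsEuler d lam M) (hN : IsEuler d lam N)
    (f : M →ₗ[Weyl K n] N) :
    Function.Surjective (weightMap d lam f) ↔
      weightSpace d (N ⧸ LinearMap.range f) lam = ⊥ := by
  rw [Submodule.eq_bot_iff]
  constructor
  · intro h y hy
    obtain ⟨y, rfl⟩ := Submodule.mkQ_surjective _ y
    obtain ⟨y', hy', heq⟩ := hN.exists_mem_weightSpace_map_eq _ hy
    obtain ⟨m, hm⟩ := h ⟨y', hy'⟩
    rw [← heq]
    exact (Submodule.Quotient.mk_eq_zero _).2 ⟨m, congrArg Subtype.val hm⟩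
  · rintro h ⟨y, hy⟩
    obtain ⟨m, rfl⟩ := (Submodule.Quotient.mk_eq_zero _).1
      (h _ (map_mem_weightSpace d (LinearMap.range f).mkQ hy))
    obtain ⟨m', hm', heq⟩ := hM.exists_mem_weightSpace_map_eq f hy
    exact ⟨⟨m', hm'⟩, Subtype.ext heq⟩

theorem isoModTorsion_eq (hd : ∀ i, 0 < d i) (hgcd : Finset.univ.gcd d = 1)
    (hlam : lam ∉ Set.range (Int.cast : ℤ → K) ∨ lam ∈ weightSemigroup K d) :
    isoModTorsion d lam =
      (MorphismProperty.isomorphisms _).inverseImage (degZeroFunctor d lam) := by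
  ext M N f
  rw [MorphismProperty.inverseImage_iff, MorphismProperty.isomorphisms.iff,
    ConcreteCategory.isIso_iff_bijective]
  refine Iff.trans (and_congr ?_ ?_) (and_congr (weightMap_injective_iff f.hom.hom)
    (weightMap_surjective_iff M.property N.property f.hom.hom)).symm
  · exact isTorsionModule_iff hd hgcd hlam (M.property.submodule _)
  · exact isTorsionModule_iff hd hgcd hlam (N.property.quotient _)

end WeightComponents

section Grading

variable {K : Type u} [Field K] [CharZero K] {n : ℕ} (d : Fin (n + 1) → ℕ)

variable (K n) in
theorem iSupIndep_weylPart : iSupIndep (weylPart (n := n) K d) := by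
  let adE : Module.End K (Weyl K n) :=
    LinearMap.mulLeft K (euler K d) - LinearMap.mulRight K (euler K d)
  refine (adE.eigenspaces_iSupIndep.comp (Int.cast_injective (α := K))).mono fun k a ha => ?_
  rw [Function.comp_apply, Module.End.mem_eigenspace_iff, Int.cast_smul_eq_zsmul, zsmul_eq_mul]
  exact sub_eq_of_eq_add' (euler_mul_of_mem K d k ha)

noncomputable instance weylGradedAlgebra : GradedAlgebra (weylPart (n := n) K d) where
  __ := weylPart_gradedMonoid K d
  __ := (DirectSum.isInternal_submodule_of_iSupIndep_of_iSup_eq_top (iSupIndep_weylPart K n d)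
    (iSup_weylPart d)).chooseDecomposition

/-- The projection of the Weyl algebra onto its component `D_0`. -/
noncomputable def degZeroProj : Weyl K n →ₗ[degZero K d] degZero K d where
  toFun b := ⟨DirectSum.decompose (weylPart K d) b 0, SetLike.coe_mem _⟩
  map_add' b c := by simp
  map_smul' a b := Subtype.ext (DirectSum.coe_decompose_mul_of_left_mem_zero (weylPart K d) a.2)

theorem degZeroProj_one : degZeroProj d (1 : Weyl K n) = 1 :=
  Subtype.ext (DirectSum.decompose_of_mem_same _ SetLike.GradedOne.one_mem)

theorem degZeroProj_mul_coe (b : Weyl K n) (a : degZero K d) :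
    degZeroProj d (b * (a : Weyl K n)) = degZeroProj d b * a :=
  Subtype.ext (DirectSum.coe_decompose_mul_of_right_mem_zero (weylPart K d) a.2)

end Grading

section EulerPartAdjunction

variable {K : Type u} [Field K] {n : ℕ} (d : Fin (n + 1) → ℕ) (lam : K)

/-- The functor sending a `D`-module to its largest `λ`-Euler submodule. -/
noncomputable def eulerPartFunctor : ModuleCat.{u} (Weyl K n) ⥤ EulerMod d lam where
  obj M := ⟨ModuleCat.of _ (eulerPart d lam M), isEuler_eulerPart d lam M⟩
  map {M _} f := ObjectProperty.homMk (ModuleCat.ofHom (f.hom.restrict fun m hm =>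
    (isEuler_eulerPart d lam M).map_mem_eulerPart (f.hom ∘ₗ (eulerPart d lam M).subtype) ⟨m, hm⟩))

/-- The inclusion of the `λ`-Euler modules into all `D`-modules is left adjoint to
`eulerPartFunctor`. -/
noncomputable def eulerPartAdjunction :
    ObjectProperty.ι (fun M : ModuleCat.{u} (Weyl K n) => IsEuler d lam M) ⊣
      eulerPartFunctor d lam :=
  Adjunction.mkOfHomEquiv
    { homEquiv M N :=
        { toFun f := ObjectProperty.homMk (ModuleCat.ofHom
            (f.hom.codRestrict (eulerPart d lam N) (M.property.map_mem_eulerPart f.hom)))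
          invFun g := g.hom ≫ ModuleCat.ofHom (eulerPart d lam N).subtype
          left_inv _ := rfl
          right_inv _ := rfl }
      homEquiv_naturality_left_symm _ _ := rfl
      homEquiv_naturality_right _ _ := rfl }

end EulerPartAdjunction

section Twisted

variable {K : Type u} [Field K] {n : ℕ} {d : Fin (n + 1) → ℕ} {lam : K}
  {M N : Type u} [AddCommGroup M] [Module (Weyl K n) M]
  [AddCommGroup N] [Module (TwistedOps d lam) N]

variable (d lam) in
theorem mk_eulerZero :
    Ideal.Quotient.mk (twistIdeal d lam) (eulerZero K d) = algebraMap K (TwistedOps d lam) lam :=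
  Ideal.Quotient.eq.2 (Ideal.subset_span rfl)

theorem semilinearMap_eq_zero_of_mem_weightSpace
    (φ : M →ₛₗ[Ideal.Quotient.mk (twistIdeal d lam)] N) {μ : K} (hμ : μ ≠ lam) {m : M}
    (hm : m ∈ weightSpace d M μ) : φ m = 0 := by
  have hE : eulerZero K d • m = algebraMap K (degZero K d) μ • m := hm
  have hφ : algebraMap K (TwistedOps d lam) lam • φ m =
      algebraMap K (TwistedOps d lam) μ • φ m := by
    rw [← mk_eulerZero, ← map_smulₛₗ, hE, map_smulₛₗ]
    rfl
  have hunit : IsUnit (algebraMap K (TwistedOps d lam) (μ - lam)) :=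
    (sub_ne_zero.2 hμ).isUnit.map _
  rw [← hunit.smul_eq_zero, map_sub, sub_smul, hφ, sub_self]

variable [CharZero K]

theorem semilinearMap_smul_eq_zero (φ : M →ₛₗ[Ideal.Quotient.mk (twistIdeal d lam)] N) {m : M}
    (hm : m ∈ weightSpace d M lam) (hφ : φ m = 0) (b : Weyl K n) : φ (b • m) = 0 := by
  induction b using Weyl.induction_weylPart (d := d) with
  | homogeneous j b hb =>
    obtain rfl | hj := eq_or_ne j 0
    · exact (map_smulₛₗ φ (⟨b, hb⟩ : degZero K d) m).trans (by rw [hφ, smul_zero])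
    · exact semilinearMap_eq_zero_of_mem_weightSpace φ (by simpa) (smul_mem_weightSpace d hb hm)
  | add a b ha hb => rw [add_smul, map_add, ha, hb, add_zero]

theorem semilinearMap_projectionOnto (hM : IsEuler d lam M)
    (φ : M →ₛₗ[Ideal.Quotient.mk (twistIdeal d lam)] N) (m : M) :
    φ (Submodule.projectionOnto _ _ hM.isCompl m) = φ m := by
  have hle : ⨆ (k : ℤ) (_ : k ≠ 0), weightSpace d M (lam + k) ≤ LinearMap.ker φ :=
    iSup₂_le fun k hk m hm => semilinearMap_eq_zero_of_mem_weightSpace φ (by simpa) hm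
  rw [← sub_eq_zero, ← map_sub, ← LinearMap.mem_ker]
  refine hle ((Submodule.projectionOnto_apply_eq_zero_iff hM.isCompl).1 ?_)
  rw [map_sub, Submodule.projectionOnto_apply_left, sub_self]

/-- Extension by zero along `M = M^λ ⊕ ⨁_{k ≠ 0} M^(λ + k)` identifies the maps on the part of
degree zero with all maps of `D_0`-modules. -/
noncomputable def weightSpaceHomEquiv (hM : IsEuler d lam M) :
    (weightSpace d M lam →ₗ[TwistedOps d lam] N) ≃
      (M →ₛₗ[Ideal.Quotient.mk (twistIdeal d lam)] N) where
  toFun φ :=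
    { toFun m := φ (Submodule.projectionOnto _ _ hM.isCompl m)
      map_add' m m' := by rw [map_add, map_add]
      map_smul' a m := by rw [map_smul, ← mk_smul_weightSpace, map_smul] }
  invFun ψ :=
    { toFun m := ψ m
      map_add' m m' := map_add ψ _ _
      map_smul' a m := by
        obtain ⟨a, rfl⟩ := Ideal.Quotient.mk_surjective a
        exact map_smulₛₗ ψ a (m : M) }
  left_inv φ := LinearMap.ext fun m =>
    congrArg φ (Submodule.projectionOnto_apply_left hM.isCompl m)
  right_inv ψ := LinearMap.ext (semilinearMap_projectionOnto hM ψ)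

end Twisted

section Coinduction

variable {K : Type u} [Field K] {n : ℕ} (d : Fin (n + 1) → ℕ) (lam : K)

/-- Restriction of scalars from `D` to `D_0`. -/
noncomputable abbrev restrictDegZero : ModuleCat.{u} (Weyl K n) ⥤ ModuleCat.{u} (degZero K d) :=
  ModuleCat.restrictScalars (SubringClass.subtype (degZero K d))

/-- Restriction of scalars along the projection `D_0 → D_0 / D_0 (E - λ)`. -/
noncomputable abbrev restrictTwistedOps :
    ModuleCat.{u} (TwistedOps d lam) ⥤ ModuleCat.{u} (degZero K d) :=
  ModuleCat.restrictScalars (Ideal.Quotient.mk (twistIdeal d lam))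

/-- The functor sending a module `N` over the twisted operators to the coinduced `D`-module
`Hom_{D_0}(D, N)`. -/
noncomputable abbrev coindFunctor : ModuleCat.{u} (TwistedOps d lam) ⥤ ModuleCat.{u} (Weyl K n) :=
  restrictTwistedOps d lam ⋙ ModuleCat.coextendScalars (SubringClass.subtype (degZero K d))

variable {d lam}

/-- Evaluation of a homomorphism `D → N` at `1`. -/
noncomputable def coindEvalOne (N : ModuleCat.{u} (TwistedOps d lam)) :
    (coindFunctor d lam).obj N →ₛₗ[Ideal.Quotient.mk (twistIdeal d lam)] N :=
  (ModuleCat.semilinearMapAddEquiv _ ((restrictDegZero d).obj ((coindFunctor d lam).obj N)) N).symm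
    ((ModuleCat.restrictCoextendScalarsAdj (SubringClass.subtype (degZero K d))).counit.app _)

theorem coindEvalOne_smul (N : ModuleCat.{u} (TwistedOps d lam)) (b : Weyl K n)
    (f : (coindFunctor d lam).obj N) :
    coindEvalOne N (b • f) = ModuleCat.CoextendScalars.equiv _ _ f b :=
  congrArg (ModuleCat.CoextendScalars.equiv _ _ f) (one_mul b)

variable [CharZero K]

/-- The homomorphism `D → N` which extends `D_0 → N`, `a ↦ a y`, by zero. -/
noncomputable def coindExtend (N : ModuleCat.{u} (TwistedOps d lam)) (y : N) :
    (coindFunctor d lam).obj N :=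
  (ModuleCat.CoextendScalars.equiv _ _).symm
    ((LinearMap.toSpanSingleton (degZero K d) ((restrictTwistedOps d lam).obj N) y).comp
      (degZeroProj d))

theorem coindExtend_mem_weightSpace (N : ModuleCat.{u} (TwistedOps d lam)) (y : N) :
    coindExtend N y ∈ weightSpace d ((coindFunctor d lam).obj N) lam := by
  rw [mem_weightSpace]
  refine ModuleCat.CoextendScalars.ext (LinearMap.ext fun b : Weyl K n => ?_)
  change Ideal.Quotient.mk (twistIdeal d lam) (degZeroProj d (b * (eulerZero K d : Weyl K n))) • y =
    Ideal.Quotient.mk (twistIdeal d lam)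
      (degZeroProj d (b * (algebraMap K (degZero K d) lam : Weyl K n))) • y
  rw [degZeroProj_mul_coe, degZeroProj_mul_coe, map_mul, map_mul, mk_eulerZero]
  rfl

theorem coindEvalOne_coindExtend (N : ModuleCat.{u} (TwistedOps d lam)) (y : N) :
    coindEvalOne N (coindExtend N y) = y := by
  change Ideal.Quotient.mk (twistIdeal d lam) (degZeroProj d 1) • y = y
  rw [degZeroProj_one, map_one, one_smul]

variable (d lam) in
/-- The right adjoint of `M ↦ M^λ` sends `N` to the largest `λ`-Euler submodule of
`Hom_{D_0}(D, N)`. -/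
noncomputable def degZeroAdjunction :
    degZeroFunctor d lam ⊣ coindFunctor d lam ⋙ eulerPartFunctor d lam :=
  Adjunction.mkOfHomEquiv
    { homEquiv M N := ModuleCat.homEquiv.trans <|
        (weightSpaceHomEquiv M.property).trans <|
        (ModuleCat.semilinearMapAddEquiv _ ((restrictDegZero d).obj M.obj) N).toEquiv.trans <|
        ((eulerPartAdjunction d lam).comp
          (ModuleCat.restrictCoextendScalarsAdj (SubringClass.subtype (degZero K d)))).homEquiv
            M ((restrictTwistedOps d lam).obj N)
      homEquiv_naturality_left_symm _ _ := rfl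
      homEquiv_naturality_right _ _ := rfl }

theorem degZeroAdjunction_counit_app_bijective (N : ModuleCat.{u} (TwistedOps d lam)) :
    Function.Bijective ((degZeroAdjunction d lam).counit.app N) := by
  constructor
  · refine (injective_iff_map_eq_zero ((degZeroAdjunction d lam).counit.app N).hom).2 ?_
    rintro ⟨⟨f, _⟩, hf⟩ hzero
    refine Subtype.ext (Subtype.ext (ModuleCat.CoextendScalars.ext ?_))
    exact LinearMap.ext fun b => (coindEvalOne_smul N b f).symm.trans <|
      semilinearMap_smul_eq_zero (coindEvalOne N) (congrArg Subtype.val hf :) hzero b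
  · intro y
    have hy := coindExtend_mem_weightSpace N y
    refine ⟨⟨⟨coindExtend N y, Submodule.mem_iSup_of_mem 0 (by simpa using hy)⟩, Subtype.ext hy⟩,
      coindEvalOne_coindExtend N y⟩

instance : IsIso (degZeroAdjunction d lam).counit :=
  have (N : ModuleCat.{u} (TwistedOps d lam)) : IsIso ((degZeroAdjunction d lam).counit.app N) :=
    (ConcreteCategory.isIso_iff_bijective _).2 (degZeroAdjunction_counit_app_bijective N)
  NatIso.isIso_of_isIso_app _

end Coinduction

section LocalizationAdjunction

open Functor Localization

variable {C D₁ D₂ : Type*} [Category* C] [Category* D₁] [Category* D₂]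
  {L : C ⥤ D₁} {F : C ⥤ D₂}

theorem isLeftAdjoint_of_isLocalization (W : MorphismProperty C) [L.IsLocalization W]
    [F.IsLocalization W] [F.IsLeftAdjoint] : L.IsLeftAdjoint :=
  isLeftAdjoint_of_iso (compUniqFunctor F L W)

theorem isEquivalence_comp_of_isLocalization (W : MorphismProperty C) [L.IsLocalization W]
    [F.IsLocalization W] {H : D₂ ⥤ C} (adjF : F ⊣ H) [IsIso adjF.counit] {ω : D₁ ⥤ C}
    (adj : L ⊣ ω) : (ω ⋙ F).IsEquivalence := by
  let e := uniq L F W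
  have adjL : L ⊣ e.functor ⋙ H :=
    (adjF.comp e.symm.toAdjunction).ofNatIsoLeft (compUniqInverse L F W)
  exact isEquivalence_of_iso (F := e.functor) <| .symm <|
    isoWhiskerRight (adj.rightAdjointUniq adjL) F ≪≫ associator _ _ _ ≪≫
      isoWhiskerLeft e.functor (asIso adjF.counit) ≪≫ rightUnitor _

end LocalizationAdjunction

theorem isLocalization_degZeroFunctor {K : Type u} [Field K] [CharZero K] {n : ℕ}
    {d : Fin (n + 1) → ℕ} {lam : K} (hd : ∀ i, 0 < d i) (hgcd : Finset.univ.gcd d = 1)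
    (hlam : lam ∉ Set.range (Int.cast : ℤ → K) ∨ lam ∈ weightSemigroup K d) :
    (degZeroFunctor d lam).IsLocalization (isoModTorsion d lam) := by
  have := (degZeroAdjunction d lam).fullyFaithfulROfIsIsoCounit.full
  have := (degZeroAdjunction d lam).fullyFaithfulROfIsIsoCounit.faithful
  rw [isoModTorsion_eq hd hgcd hlam]
  exact (degZeroAdjunction d lam).isLocalization

end WeightedDMod

theorem mainTheorem1 {K : Type u} [Field K] [CharZero K] {n : ℕ} (hn : 1 ≤ n)
    (d : Fin (n + 1) → ℕ) (hd : ∀ i, 0 < d i) (hgcd : Finset.univ.gcd d = 1)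
    (lam : K)
    (hlam : lam ∉ Set.range (Int.cast : ℤ → K) ∨ lam ∈ WeightedDMod.weightSemigroup K d) :
    (WeightedDMod.quotientFunctor d lam).IsLeftAdjoint ∧
      ∀ (ω : WeightedDMod.TwistedDMod d lam ⥤ WeightedDMod.EulerMod d lam)
        (adj : WeightedDMod.quotientFunctor d lam ⊣ ω),
        (WeightedDMod.globalSections d lam ω adj).IsEquivalence := by
  open WeightedDMod in
  have := isLocalization_degZeroFunctor hd hgcd hlam
  have := (degZeroAdjunction d lam).isLeftAdjoint
  exact ⟨isLeftAdjoint_of_isLocalization (isoModTorsion d lam) (F := degZeroFunctor d lam),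
    fun _ adj => isEquivalence_comp_of_isLocalization (isoModTorsion d lam)
      (degZeroAdjunction d lam) adj⟩
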